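/- There exist universal constants $C_0,c>0$ such that the following holds. Let $\mathbb K\in\{\mathbb R,\mathbb C\}$ and let $A\in\mathbb K^{m\times n}$ be a nonzero matrix of rank $k$, with stable rank $r=\|A\|_F^2/\|A\|_2^2$ and condition number $\kappa(A)=\sigma_1(A)/\sigma_k(A)$, where $\sigma_1(A)\ge\dots\ge\sigma_k(A)>0$ are the nonzero singular values of $A$. Let $A=W\Sigma V^*$ be any full singular value decomposition, with $W,V$ unitary and the singular values in decreasing order on the diagonal of $\Sigma$. Let $W_k,V_k$ consist of the first $k$ columns of $W$ and $V$. The rank-$k$ leverage score distributions on the columns and rows of $A$ are \[ p_j^{\mathrm{lev},k}=\tfrac1k\|V_k(j,:)\|_2^2\quad(1\le j\le n),\qquad q_i^{\mathrm{lev},k}=\tfrac1k\|W_k(i,:)\|_2^2\quad(1\le i\le m). \] Then \[ p_j^{\mathrm{lev},k}\ \ge\ \frac rk\,\frac{\|A(:,j)\|_2^2}{\|A\|_F^2}\ \text{ for all } j,\qquad q_i^{\mathrm{lev},k}\ \ge\ \frac rk\,\frac{\|A(i,:)\|_2^2}{\|A\|_F^2}\ \text{ for all } i. \] Moreover, set $\alpha=\beta=\sqrt{r/k}$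 and $\gamma=\min\{\alpha,\beta\}$, let $\delta\in(0,1)$ and $0<\varepsilon<\min\{\kappa(A)^{-1},\,\delta^{-1/4}\sqrt{2\gamma}\}$, and let $d_1,d_2\in\mathbb N$ satisfy \[ d_1,\,d_2\ \ge\ C_0\,\frac{r}{\varepsilon^4\delta}\log\Big(\frac{r}{\varepsilon^4\delta}\Big). \] Sample $d_1$ row indices $I$ according to $q^{\mathrm{lev},k}$ and $d_2$ column indices $J$ according to $p^{\mathrm{lev},k}$, all independently and with replacement, and put $C=A(:,J)$, $U=A(I,J)$, $R=A(I,:)$ (repeated indices are kept). Then, with $U^\dagger$ the Moore--Penrose pseudoinverse of $U$, \[ \mathbb P\big(\operatorname{rank}(U)=k\ \text{ and }\ A=CU^\dagger R\big)\ \ge\ \Big(1-2\exp\Big(-\frac{c\,r}{k\,\delta}\Big)\Big)^2 . \] -/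

import Mathlib

open MeasureTheory ProbabilityTheory

noncomputable section

namespace CUR

variable {𝕂 : Type*} [RCLike 𝕂]

/-- The `i`-th singular value of `A` (decreasing order, indexed from `0`, extended by zeros). -/
def singVal {m n : ℕ} (A : Matrix (Fin m) (Fin n) 𝕂) (i : ℕ) : ℝ :=
  (Matrix.toEuclideanLin A).singularValues i

/-- The spectral norm of `A`: the operator norm between Euclidean spaces. -/
def specNorm {m n : ℕ} (A : Matrix (Fin m) (Fin n) 𝕂) : ℝ :=
  ‖(Matrix.toEuclideanLin A).toContinuousLinearMap‖

/-- The square of the Frobenius norm. -/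
def frobSq {m n : ℕ} (A : Matrix (Fin m) (Fin n) 𝕂) : ℝ :=
  ∑ i, ∑ j, ‖A i j‖ ^ 2

/-- The stable rank: squared Frobenius norm over squared spectral norm. -/
def stableRank {m n : ℕ} (A : Matrix (Fin m) (Fin n) 𝕂) : ℝ :=
  frobSq A / specNorm A ^ 2

/-- The generalized spectral condition number: largest over smallest nonzero singular value. -/
def condNumber {m n : ℕ} (A : Matrix (Fin m) (Fin n) 𝕂) : ℝ :=
  singVal A 0 / singVal A (A.rank - 1)

/-- `A = W Σ V*` is a (full) singular value decomposition: `W` and `V` are unitary and `Σ` is the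
rectangular diagonal matrix of the singular values of `A` in decreasing order. -/
structure IsSVD {m n : ℕ} (A : Matrix (Fin m) (Fin n) 𝕂) (W : Matrix (Fin m) (Fin m) 𝕂)
    (V : Matrix (Fin n) (Fin n) 𝕂) : Prop where
  left_unitary : W ∈ Matrix.unitaryGroup (Fin m) 𝕂
  right_unitary : V ∈ Matrix.unitaryGroup (Fin n) 𝕂
  factorization : A = W * Matrix.of (fun (i : Fin m) (j : Fin n) =>
    if (i : ℕ) = (j : ℕ) then ((singVal A i : ℝ) : 𝕂) else 0) * V.conjTranspose

/-- The length-squared column distribution. -/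
def colProb {m n : ℕ} (A : Matrix (Fin m) (Fin n) 𝕂) (j : Fin n) : ℝ :=
  (∑ i, ‖A i j‖ ^ 2) / frobSq A

/-- The length-squared row distribution. -/
def rowProb {m n : ℕ} (A : Matrix (Fin m) (Fin n) 𝕂) (i : Fin m) : ℝ :=
  (∑ j, ‖A i j‖ ^ 2) / frobSq A

/-- The rank-`k` leverage score distribution `(1/k) ‖X_k(j,:)‖²`, where `X_k` consists of the first
`k` columns of the matrix `X` of singular vectors (`X = V` gives the column distribution,
`X = W` the row distribution). -/
def levProb {N : ℕ} (X : Matrix (Fin N) (Fin N) 𝕂) (k : ℕ) (j : Fin N) : ℝ :=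
  (1 / (k : ℝ)) * ∑ l ∈ Finset.univ.filter (fun l : Fin N => (l : ℕ) < k), ‖X j l‖ ^ 2

/-- The four Penrose equations. -/
structure IsPseudoinverse {m n : ℕ} (A : Matrix (Fin m) (Fin n) 𝕂)
    (X : Matrix (Fin n) (Fin m) 𝕂) : Prop where
  mul_mul_left : A * X * A = A
  mul_mul_right : X * A * X = X
  herm_left : (A * X).conjTranspose = A * X
  herm_right : (X * A).conjTranspose = X * A

/-- Every matrix has a singular value decomposition. -/
theorem exists_isSVD {m n : ℕ} (A : Matrix (Fin m) (Fin n) 𝕂) :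
    ∃ (W : Matrix (Fin m) (Fin m) 𝕂) (V : Matrix (Fin n) (Fin n) 𝕂), IsSVD A W V := by
  classical
  set T := Matrix.toEuclideanLin A with hT
  have hn : Module.finrank 𝕂 (EuclideanSpace 𝕂 (Fin n)) = n := by simp
  set b := T.isSymmetric_adjoint_comp_self.eigenvectorBasis hn with hb
  have hin : ∀ i j : Fin n, inner 𝕂 (T (b i)) (T (b j)) =
      ((T.singularValues j ^ 2 : ℝ) : 𝕂) * (if i = j then 1 else 0) := by
    intro i j
    rw [← LinearMap.adjoint_inner_right, ← LinearMap.comp_apply, hb,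
      LinearMap.IsSymmetric.apply_eigenvectorBasis, inner_smul_right, T.sq_singularValues_fin hn]
    congr 1
    exact orthonormal_iff_ite.mp (OrthonormalBasis.orthonormal _) i j
  have hzero : ∀ j : Fin n, T.singularValues j = 0 → T (b j) = 0 := by
    intro j hj
    have := hin j j
    rw [hj] at this
    simpa using this
  let w : Fin m → EuclideanSpace 𝕂 (Fin m) := fun i =>
    if h : (i : ℕ) < n then ((T.singularValues i : ℝ) : 𝕂)⁻¹ • T (b ⟨i, h⟩) else 0
  let s : Set (Fin m) := {i | T.singularValues i ≠ 0}
  have hs : ∀ i ∈ s, (i : ℕ) < n := by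
    intro i hi
    by_contra h
    exact hi (T.singularValues_of_finrank_le (by simpa using h))
  have hw : Orthonormal 𝕂 (s.domRestrict w) := by
    rw [orthonormal_iff_ite]
    rintro ⟨i, hi⟩ ⟨j, hj⟩
    have hi0 : ((T.singularValues i : ℝ) : 𝕂) ≠ 0 := RCLike.ofReal_ne_zero.mpr hi
    have hj0 : ((T.singularValues j : ℝ) : 𝕂) ≠ 0 := RCLike.ofReal_ne_zero.mpr hj
    simp only [Set.domRestrict_apply, w, hs i hi, hs j hj, dif_pos, inner_smul_left,
      inner_smul_right, hin]
    by_cases hij : i = j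
    · subst hij
      simp
      field_simp
    · have : (i : ℕ) ≠ j := fun h => hij (Fin.ext h)
      simp [hij, this]
  obtain ⟨u, hu⟩ := hw.exists_orthonormalBasis_extension_of_card_eq (by simp)
  have uni : ∀ {N : ℕ} (f : OrthonormalBasis (Fin N) 𝕂 (EuclideanSpace 𝕂 (Fin N))),
      Matrix.of (fun i l => f l i) ∈ Matrix.unitaryGroup (Fin N) 𝕂 := by
    intro N f
    rw [Matrix.mem_unitaryGroup_iff']
    ext i j
    have := orthonormal_iff_ite.mp f.orthonormal i j
    rw [PiLp.inner_apply] at this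
    simpa [Matrix.mul_apply, Matrix.one_apply, Matrix.star_apply, mul_comm] using this
  refine ⟨Matrix.of (fun i l => u l i), Matrix.of (fun i l => b l i), uni u, uni b, ?_⟩
  have hV := (Matrix.mem_unitaryGroup_iff).mp (uni b)
  have key : A * Matrix.of (fun i l => b l i) = Matrix.of (fun i l => u l i) *
      Matrix.of (fun (i : Fin m) (j : Fin n) =>
        if (i : ℕ) = (j : ℕ) then ((singVal A i : ℝ) : 𝕂) else 0) := by
    ext i l
    have h1 : (A * Matrix.of (fun i l => b l i)) i l = T (b l) i := by
      simp [hT, Matrix.mul_apply, Matrix.toLpLin_apply, Matrix.mulVec, dotProduct]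
    rw [h1, Matrix.mul_apply]
    by_cases h0 : T.singularValues l = 0
    · rw [hzero l h0]
      symm
      apply Finset.sum_eq_zero
      intro x _
      by_cases hx : (x : ℕ) = l
      · simp [hx, singVal, ← hT, h0]
      · simp [hx]
    · have hlm : (l : ℕ) < m := by
        have h2 : 0 < T.singularValues l := (T.singularValues_pos_iff_ne_zero _).mpr h0
        rw [T.singularValues_pos_iff_lt_finrank_range] at h2
        exact h2.trans_le ((Submodule.finrank_le _).trans (by simp))
      rw [Finset.sum_eq_single (⟨l, hlm⟩ : Fin m)]
      · have h3 := hu ⟨l, hlm⟩ (show _ ∈ s from h0)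
        have h4 : ((T.singularValues l : ℝ) : 𝕂) ≠ 0 := by simpa using h0
        simp [h3, w, singVal, ← hT]
        field_simp
      · intro x _ hx
        have : (x : ℕ) ≠ l := fun h => hx (Fin.ext h)
        simp [this]
      · simp
  rw [← key, Matrix.mul_assoc, ← Matrix.star_eq_conjTranspose, hV, Matrix.mul_one]

theorem exists_isPseudoinverse {m n : ℕ} (A : Matrix (Fin m) (Fin n) 𝕂) :
    ∃ X : Matrix (Fin n) (Fin m) 𝕂, IsPseudoinverse A X := by
  classical
  obtain ⟨W, V, hW, hV, hA⟩ := exists_isSVD A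
  set D : Matrix (Fin m) (Fin n) 𝕂 := Matrix.of (fun (i : Fin m) (j : Fin n) =>
    if (i : ℕ) = (j : ℕ) then ((singVal A i : ℝ) : 𝕂) else 0) with hD
  set E : Matrix (Fin n) (Fin m) 𝕂 := Matrix.of (fun (i : Fin n) (j : Fin m) =>
    if (i : ℕ) = (j : ℕ) then ((singVal A i : ℝ) : 𝕂)⁻¹ else 0) with hE
  have hW' : W.conjTranspose * W = 1 := Matrix.mem_unitaryGroup_iff'.mp hW
  have hV' : V.conjTranspose * V = 1 := Matrix.mem_unitaryGroup_iff'.mp hV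
  have diag : ∀ {p q : ℕ} (f g : ℕ → 𝕂), Matrix.of (fun (i : Fin p) (j : Fin q) =>
      if (i : ℕ) = (j : ℕ) then f i else 0) * Matrix.of (fun (i : Fin q) (j : Fin p) =>
      if (i : ℕ) = (j : ℕ) then g i else 0) = Matrix.diagonal (fun i : Fin p =>
      if (i : ℕ) < q then f i * g i else 0) := by
    intro p q f g
    ext i j
    rw [Matrix.mul_apply, Matrix.diagonal_apply]
    by_cases hi : (i : ℕ) < q
    · rw [Finset.sum_eq_single (⟨i, hi⟩ : Fin q)]
      · simp [hi, Fin.ext_iff]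
      · intro x _ hx
        have : (i : ℕ) ≠ x := fun h => hx (Fin.ext h.symm)
        simp [this]
      · simp
    · rw [Finset.sum_eq_zero]
      · simp [hi]
      · intro x _
        have : (i : ℕ) ≠ x := fun h => hi (h ▸ x.2)
        simp [this]
  have hDE : D * E = _ := diag (p := m) (q := n) (fun i => ((singVal A i : ℝ) : 𝕂))
    (fun i => ((singVal A i : ℝ) : 𝕂)⁻¹)
  have hED : E * D = _ := diag (p := n) (q := m) (fun i => ((singVal A i : ℝ) : 𝕂)⁻¹)
    (fun i => ((singVal A i : ℝ) : 𝕂))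
  have hAX : A * (V * E * W.conjTranspose) = W * (D * E) * W.conjTranspose := by
    calc A * (V * E * W.conjTranspose)
        = W * D * (V.conjTranspose * V) * E * W.conjTranspose := by
          rw [hA]; simp only [Matrix.mul_assoc]
      _ = _ := by rw [hV']; simp only [Matrix.mul_assoc, Matrix.one_mul]
  have hXA : (V * E * W.conjTranspose) * A = V * (E * D) * V.conjTranspose := by
    calc (V * E * W.conjTranspose) * A
        = V * E * (W.conjTranspose * W) * D * V.conjTranspose := by
          rw [hA]; simp only [Matrix.mul_assoc]
      _ = _ := by rw [hW']; simp only [Matrix.mul_assoc, Matrix.one_mul]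
  have hDED : D * E * D = D := by
    rw [hDE]
    ext i j
    rw [Matrix.diagonal_mul, hD, Matrix.of_apply]
    by_cases hij : (i : ℕ) = j
    · have hi : (i : ℕ) < n := hij ▸ j.2
      by_cases h0 : ((singVal A i : ℝ) : 𝕂) = 0
      · simp [h0]
      · simp [hi, h0]
    · simp [hij]
  have hEDE : E * D * E = E := by
    rw [hED]
    ext i j
    rw [Matrix.diagonal_mul, hE, Matrix.of_apply]
    by_cases hij : (i : ℕ) = j
    · have hi : (i : ℕ) < m := hij ▸ j.2
      by_cases h0 : ((singVal A i : ℝ) : 𝕂) = 0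
      · simp [h0]
      · simp [hi, h0]
    · simp [hij]
  have hsd : ∀ {p q : ℕ} (f : Fin p → 𝕂) (Z : Matrix (Fin q) (Fin p) 𝕂),
      (∀ i, star (f i) = f i) →
      (Z * Matrix.diagonal f * Z.conjTranspose).conjTranspose =
        Z * Matrix.diagonal f * Z.conjTranspose := by
    intro p q f Z hf
    have : star f = f := funext hf
    rw [Matrix.conjTranspose_mul, Matrix.conjTranspose_mul, Matrix.conjTranspose_conjTranspose,
      Matrix.diagonal_conjTranspose, this, Matrix.mul_assoc]
  refine ⟨V * E * W.conjTranspose, ?_, ?_, ?_, ?_⟩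
  · calc A * (V * E * W.conjTranspose) * A
        = W * (D * E) * (W.conjTranspose * W) * D * V.conjTranspose := by
          rw [hAX]; conv_lhs => rw [hA]
          simp only [Matrix.mul_assoc]
      _ = W * (D * E * D) * V.conjTranspose := by
          rw [hW']; simp only [Matrix.mul_assoc, Matrix.one_mul]
      _ = A := by rw [hDED, ← hA]
  · calc (V * E * W.conjTranspose) * A * (V * E * W.conjTranspose)
        = V * (E * D) * (V.conjTranspose * V) * E * W.conjTranspose := by
          rw [hXA]; simp only [Matrix.mul_assoc]
      _ = V * (E * D * E) * W.conjTranspose := by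
          rw [hV']; simp only [Matrix.mul_assoc, Matrix.one_mul]
      _ = _ := by rw [hEDE]
  · rw [hAX, hDE]
    apply hsd
    intro i
    split_ifs <;> simp
  · rw [hXA, hED]
    apply hsd
    intro i
    split_ifs <;> simp

/-- The Moore-Penrose pseudoinverse. -/
def pinv {m n : ℕ} (A : Matrix (Fin m) (Fin n) 𝕂) : Matrix (Fin n) (Fin m) 𝕂 :=
  Classical.choose (exists_isPseudoinverse A)

theorem pinv_spec {m n : ℕ} (A : Matrix (Fin m) (Fin n) 𝕂) : IsPseudoinverse A (pinv A) :=
  Classical.choose_spec (exists_isPseudoinverse A)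

/-- The Penrose equations determine the pseudoinverse. -/
theorem IsPseudoinverse.eq_of {m n : ℕ} {A : Matrix (Fin m) (Fin n) 𝕂}
    {X Y : Matrix (Fin n) (Fin m) 𝕂} (hX : IsPseudoinverse A X) (hY : IsPseudoinverse A Y) :
    X = Y := by
  have h1 : A * X = A * Y := by
    calc A * X = (A * X).conjTranspose := hX.herm_left.symm
      _ = ((A * Y) * (A * X)).conjTranspose := by
          rw [← Matrix.mul_assoc (A * Y), hY.mul_mul_left]
      _ = (A * X) * (A * Y) := by
          rw [Matrix.conjTranspose_mul, hX.herm_left, hY.herm_left]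
      _ = A * Y := by rw [← Matrix.mul_assoc, hX.mul_mul_left]
  have h2 : X * A = Y * A := by
    calc X * A = (X * A).conjTranspose := hX.herm_right.symm
      _ = ((X * A) * (Y * A)).conjTranspose := by
          rw [Matrix.mul_assoc, ← Matrix.mul_assoc A, hY.mul_mul_left]
      _ = (Y * A) * (X * A) := by
          rw [Matrix.conjTranspose_mul, hX.herm_right, hY.herm_right]
      _ = Y * A := by rw [Matrix.mul_assoc, ← Matrix.mul_assoc A, hX.mul_mul_left]
  calc X = X * A * X := hX.mul_mul_right.symm
    _ = Y * (A * Y) := by rw [h2, Matrix.mul_assoc, h1]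
    _ = Y := by rw [← Matrix.mul_assoc, hY.mul_mul_right]

end CUR

end

/-! By the thin SVD, `A = X D Yᴴ` with orthonormal columns in `X` and `Y` and `D` invertible of size
`k`. The column norms of `A` are `∑ σ_l² |Y j l|²`, and `σ_l ≤ ‖A‖₂` gives the leverage bounds
(`stableRank_div_mul_prob_le`).

For the sampling claim no matrix concentration is needed. If the sampled rows of `X` and of `Y` both
span `𝕂^k`, then `rank U = k` and `A = C U† R` exactly (`cur_exact`). The rows of `X` form a
Parseval frame of `𝕂^k`, and leverage sampling picks them proportionally to squared norm. The frame
mass outside a subspace is at least its codimension, so each draw shrinks the expected codimension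
of the span by a factor `1 - 1/k`. By Markov, spanning fails with probability at most `k (1 -
1/k)^d` (`measureReal_span_ne_top_le`).

Put `e = exp(-r/(kδ))`. The sample size makes this failure probability at most `2e(1 - e)`
(`mul_pow_le_exp_mul_one_sub_exp`). A union bound over rows and columns leaves `1 - 4e(1 - e)`,
which is exactly `(1 - 2e)²`. -/

namespace CUR

/-! ### Random sampling from a Parseval frame. -/

section TightFrame

variable {𝕂 E ι : Type*} [RCLike 𝕂] [NormedAddCommGroup E] [InnerProductSpace 𝕂 E]
  [FiniteDimensional 𝕂 E] [Fintype ι] {w : ι → E}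

open Classical in
/-- The part of a Parseval frame lying outside a subspace has mass at least its codimension. -/
theorem finrank_orthogonal_le_sum_notMem (hw : ∀ u, ∑ i, ‖inner 𝕂 (w i) u‖ ^ 2 = ‖u‖ ^ 2)
    (S : Submodule 𝕂 E) :
    (Module.finrank 𝕂 Sᗮ : ℝ) ≤ ∑ i, if w i ∈ S then 0 else ‖w i‖ ^ 2 := by
  let b := stdOrthonormalBasis 𝕂 Sᗮ
  have hb : Orthonormal 𝕂 (fun l => (b l : E)) :=
    b.orthonormal.comp_linearIsometry Sᗮ.subtypeₗᵢ
  calc (Module.finrank 𝕂 Sᗮ : ℝ) = ∑ l, ‖(b l : E)‖ ^ 2 := by simp [hb.1]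
    -- Parseval expands each unit basis vector of `Sᗮ`. After exchanging the sums, frame vectors in
    -- `S` contribute nothing and Bessel bounds the others by `‖w i‖ ^ 2`.
    _ = ∑ l, ∑ i, ‖inner 𝕂 (w i) (b l : E)‖ ^ 2 := by simp only [hw]
    _ = ∑ i, ∑ l, ‖inner 𝕂 (w i) (b l : E)‖ ^ 2 := Finset.sum_comm
    _ ≤ _ := by
      refine Finset.sum_le_sum fun i _ => ?_
      split_ifs with h
      · refine (Finset.sum_eq_zero fun l _ => ?_).le
        rw [Submodule.inner_right_of_mem_orthogonal h (b l).2]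
        simp
      · simp only [norm_inner_symm (w i)]
        exact hb.sum_inner_products_le (w i)

/-- The squared norms of a Parseval frame sum up to the dimension. -/
theorem sum_norm_sq_eq_finrank (hw : ∀ u, ∑ i, ‖inner 𝕂 (w i) u‖ ^ 2 = ‖u‖ ^ 2) :
    ∑ i, ‖w i‖ ^ 2 = Module.finrank 𝕂 E := by
  let b := stdOrthonormalBasis 𝕂 E
  calc ∑ i, ‖w i‖ ^ 2 = ∑ i, ∑ l, ‖inner 𝕂 (w i) (b l)‖ ^ 2 := by
        simp only [b.sum_sq_norm_inner_left]
    _ = ∑ l, ∑ i, ‖inner 𝕂 (w i) (b l)‖ ^ 2 := Finset.sum_comm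
    _ = _ := by simp [hw]

variable (𝕂) in
/-- The codimension of the span of a finite family. -/
noncomputable def spanCodim {κ : Type*} (v : κ → E) : ℕ :=
  Module.finrank 𝕂 (Submodule.span 𝕂 (Set.range v))ᗮ

-- A vector outside the span enlarges it strictly, so the codimension drops by at least one.
open Classical in
theorem spanCodim_cons_add_le {d : ℕ} (x : E) (v : Fin d → E) :
    spanCodim 𝕂 (Fin.cons x v : Fin (d + 1) → E) +
      (if x ∈ Submodule.span 𝕂 (Set.range v) then 0 else 1) ≤ spanCodim 𝕂 v := by
  unfold spanCodim
  rw [Fin.range_cons]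
  set S := Submodule.span 𝕂 (Set.range v)
  set T := Submodule.span 𝕂 (insert x (Set.range v))
  have hST : S ≤ T := Submodule.span_mono (Set.subset_insert _ _)
  have hS := S.finrank_add_finrank_orthogonal
  have hT := T.finrank_add_finrank_orthogonal
  split_ifs with h
  · have := Submodule.finrank_mono hST
    omega
  · have : S < T := lt_of_le_of_ne hST fun h' =>
      h (h' ▸ Submodule.subset_span (Set.mem_insert _ _))
    have := Submodule.finrank_lt_finrank_of_lt this
    omega

/-- Sampling one more vector of a Parseval frame with probabilities proportional to the squared
norms contracts the expected codimension. -/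
theorem sum_mul_spanCodim_cons_le (hw : ∀ u, ∑ i, ‖inner 𝕂 (w i) u‖ ^ 2 = ‖u‖ ^ 2)
    {k : ℕ} (hk : 0 < k) (hE : Module.finrank 𝕂 E = k) {p : ι → ℝ}
    (hp : ∀ i, p i = 1 / k * ‖w i‖ ^ 2) {d : ℕ} (v : Fin d → E) :
    ∑ i, p i * spanCodim 𝕂 (Fin.cons (w i) v : Fin (d + 1) → E) ≤
      (1 - 1 / k) * spanCodim 𝕂 v := by
  classical
  have hk' : (0 : ℝ) < k := by exact_mod_cast hk
  have hp0 : ∀ i, 0 ≤ p i := fun i => by rw [hp]; positivity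
  have hp1 : ∑ i, p i = 1 := by
    simp only [hp, ← Finset.mul_sum, sum_norm_sq_eq_finrank hw, hE]
    field_simp
  -- The subtracted term is `p i` exactly when `w i` is new. Summed over `i` it is `1/k` times the
  -- mass outside the span, hence at least `1/k` times the codimension.
  have h1 : ∀ i, p i * spanCodim 𝕂 (Fin.cons (w i) v : Fin (d + 1) → E) ≤
      p i * spanCodim 𝕂 v -
        1 / k * (if w i ∈ Submodule.span 𝕂 (Set.range v) then 0 else ‖w i‖ ^ 2) := by
    intro i
    have h := spanCodim_cons_add_le (𝕂 := 𝕂) (w i) v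
    have h' : (spanCodim 𝕂 (Fin.cons (w i) v : Fin (d + 1) → E) : ℝ) ≤ spanCodim 𝕂 v -
        (if w i ∈ Submodule.span 𝕂 (Set.range v) then 0 else 1) := by
      rw [le_sub_iff_add_le]
      split_ifs at h ⊢ <;> exact_mod_cast h
    refine (mul_le_mul_of_nonneg_left h' (hp0 i)).trans_eq ?_
    split_ifs
    · simp
    · rw [mul_sub, mul_one, ← hp]
  refine (Finset.sum_le_sum fun i _ => h1 i).trans ?_
  rw [Finset.sum_sub_distrib, ← Finset.sum_mul, hp1, ← Finset.mul_sum, sub_mul]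
  have h2 := finrank_orthogonal_le_sum_notMem hw (Submodule.span 𝕂 (Set.range v))
  gcongr
  exact h2

/-- The expected codimension of the span of `d` independent samples. -/
theorem sum_prod_mul_spanCodim_le (hw : ∀ u, ∑ i, ‖inner 𝕂 (w i) u‖ ^ 2 = ‖u‖ ^ 2)
    {k : ℕ} (hk : 0 < k) (hE : Module.finrank 𝕂 E = k) {p : ι → ℝ}
    (hp : ∀ i, p i = 1 / k * ‖w i‖ ^ 2) (d : ℕ) :
    ∑ f : Fin d → ι, (∏ a, p (f a)) * spanCodim 𝕂 (w ∘ f) ≤ k * (1 - 1 / k) ^ d := by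
  classical
  have hp0 : ∀ i, 0 ≤ p i := fun i => by rw [hp]; positivity
  have hk1 : (0 : ℝ) ≤ 1 - 1 / k := by
    rw [sub_nonneg]
    exact div_le_one_of_le₀ (by exact_mod_cast hk) (by positivity)
  induction d with
  | zero =>
    simpa [spanCodim, hE] using
      Submodule.finrank_le (Submodule.span 𝕂 (Set.range (w ∘ default)))ᗮ
  | succ d ih =>
    -- Split off one sample and average over it with the remaining ones fixed, so that the one-step
    -- contraction applies.
    rw [← (Fin.consEquiv fun _ => ι).sum_comp, Fintype.sum_prod_type_right]
    calc _ = ∑ f : Fin d → ι, (∏ a, p (f a)) *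
          ∑ i, p i * spanCodim 𝕂 (Fin.cons (w i) (w ∘ f) : Fin (d + 1) → E) := by
          refine Finset.sum_congr rfl fun f _ => ?_
          rw [Finset.mul_sum]
          refine Finset.sum_congr rfl fun i _ => ?_
          have : w ∘ (Fin.consEquiv fun _ => ι) (i, f) = Fin.cons (w i) (w ∘ f) := by
            ext a
            refine Fin.cases ?_ (fun a => ?_) a <;> simp
          rw [this]
          simp only [Fin.consEquiv_apply, Fin.prod_univ_succ, Fin.cons_zero, Fin.cons_succ]
          ring
      _ ≤ ∑ f : Fin d → ι, (∏ a, p (f a)) * ((1 - 1 / k) * spanCodim 𝕂 (w ∘ f)) :=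
          Finset.sum_le_sum fun f _ => mul_le_mul_of_nonneg_left
            (sum_mul_spanCodim_cons_le hw hk hE hp _) (Finset.prod_nonneg fun a _ => hp0 _)
      _ = (1 - 1 / k) * ∑ f : Fin d → ι, (∏ a, p (f a)) * spanCodim 𝕂 (w ∘ f) := by
          rw [Finset.mul_sum]
          exact Finset.sum_congr rfl fun f _ => by ring
      _ ≤ (1 - 1 / k) * (k * (1 - 1 / k) ^ d) := mul_le_mul_of_nonneg_left ih hk1
      _ = _ := by ring

/-- Independent samples of a Parseval frame, with probabilities proportional to the squared norms,
fail to span with exponentially small probability. -/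
theorem measureReal_span_ne_top_le (hw : ∀ u, ∑ i, ‖inner 𝕂 (w i) u‖ ^ 2 = ‖u‖ ^ 2)
    {k : ℕ} (hk : 0 < k) (hE : Module.finrank 𝕂 E = k) {p : ι → ℝ}
    (hp : ∀ i, p i = 1 / k * ‖w i‖ ^ 2) [MeasurableSpace ι] [MeasurableSingletonClass ι]
    {Ω : Type*} [MeasurableSpace Ω] {μ : Measure Ω} [IsProbabilityMeasure μ] {d : ℕ}
    {I : Fin d → Ω → ι} (hI : iIndepFun I μ)
    (hlaw : ∀ a i, μ.real {ω | I a ω = i} = p i) :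
    μ.real {ω | Submodule.span 𝕂 (Set.range fun a => w (I a ω)) ≠ ⊤} ≤
      k * (1 - 1 / k) ^ d := by
  classical
  have hp0 : ∀ i, 0 ≤ p i := fun i => by rw [hp]; positivity
  have hpt : ∀ f : Fin d → ι, μ.real {ω | ∀ a, I a ω = f a} = ∏ a, p (f a) := by
    intro f
    have h := hI.measure_inter_preimage_eq_mul Finset.univ (sets := fun a => {f a})
      (fun a _ => MeasurableSet.singleton _)
    have h' : {ω | ∀ a, I a ω = f a} = ⋂ a ∈ Finset.univ, I a ⁻¹' {f a} := by
      ext ω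
      simp
    rw [h', measureReal_def, h, ENNReal.toReal_prod]
    exact Finset.prod_congr rfl fun a _ => hlaw a (f a)
  set B : Finset (Fin d → ι) := Finset.univ.filter fun f =>
    Submodule.span 𝕂 (Set.range (w ∘ f)) ≠ ⊤ with hB
  have hsub : {ω | Submodule.span 𝕂 (Set.range fun a => w (I a ω)) ≠ ⊤} ⊆
      ⋃ f ∈ B, {ω | ∀ a, I a ω = f a} := by
    intro ω hω
    simp only [Set.mem_iUnion]
    exact ⟨fun a => I a ω, by simpa [hB, Function.comp_def] using hω, fun a => rfl⟩
  calc _ ≤ μ.real (⋃ f ∈ B, {ω | ∀ a, I a ω = f a}) := measureReal_mono hsub (measure_ne_top _ _)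
    _ ≤ ∑ f ∈ B, μ.real {ω | ∀ a, I a ω = f a} := measureReal_biUnion_finset_le _ _
    _ = ∑ f ∈ B, ∏ a, p (f a) := Finset.sum_congr rfl fun f _ => hpt f
    -- Markov's inequality: the codimension is an integer, so it is at least `1` on every tuple that
    -- fails to span.
    _ ≤ ∑ f ∈ B, (∏ a, p (f a)) * spanCodim 𝕂 (w ∘ f) := by
        refine Finset.sum_le_sum fun f hf => le_mul_of_one_le_right
          (Finset.prod_nonneg fun a _ => hp0 _) ?_
        rw [Nat.one_le_cast, Nat.one_le_iff_ne_zero]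
        intro h0
        exact (Finset.mem_filter.mp hf).2
          ((Submodule.orthogonal_eq_bot_iff).mp (Submodule.finrank_eq_zero.mp h0))
    _ ≤ ∑ f, (∏ a, p (f a)) * spanCodim 𝕂 (w ∘ f) :=
        Finset.sum_le_univ_sum_of_nonneg fun f =>
          mul_nonneg (Finset.prod_nonneg fun a _ => hp0 _) (by positivity)
    _ ≤ _ := sum_prod_mul_spanCodim_le hw hk hE hp d

end TightFrame

/-! ### Matrices with orthonormal columns. -/

section Isometry

variable {𝕂 : Type*} [RCLike 𝕂]

theorem star_dotProduct_self_eq_sum {ι : Type*} [Fintype ι] (u : ι → 𝕂) :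
    star u ⬝ᵥ u = ((∑ i, ‖u i‖ ^ 2 : ℝ) : 𝕂) := by
  simp [dotProduct, RCLike.conj_mul]

theorem sum_norm_sq_mulVec {ι κ : Type*} [Fintype ι] [Fintype κ] [DecidableEq κ]
    {X : Matrix ι κ 𝕂} (hX : X.conjTranspose * X = 1) (v : κ → 𝕂) :
    ∑ i, ‖X.mulVec v i‖ ^ 2 = ∑ l, ‖v l‖ ^ 2 := by
  rw [← RCLike.ofReal_inj (K := 𝕂), ← star_dotProduct_self_eq_sum, ← star_dotProduct_self_eq_sum,
    Matrix.star_mulVec, Matrix.dotProduct_mulVec,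
    Matrix.vecMul_vecMul, hX, Matrix.vecMul_one]

theorem sum_norm_sq_mul_apply {ι κ τ : Type*} [Fintype ι] [Fintype κ] [DecidableEq κ]
    {X : Matrix ι κ 𝕂} (hX : X.conjTranspose * X = 1) (M : Matrix κ τ 𝕂) (j : τ) :
    ∑ i, ‖(X * M) i j‖ ^ 2 = ∑ l, ‖M l j‖ ^ 2 :=
  sum_norm_sq_mulVec hX fun l => M l j

/-- Bessel's inequality for a matrix with orthonormal columns. -/
theorem sum_norm_sq_conjTranspose_mulVec_le {ι κ : Type*} [Fintype ι] [Fintype κ] [DecidableEq κ]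
    {X : Matrix ι κ 𝕂} (hX : X.conjTranspose * X = 1) (v : ι → 𝕂) :
    ∑ l, ‖X.conjTranspose.mulVec v l‖ ^ 2 ≤ ∑ i, ‖v i‖ ^ 2 := by
  have hon : Orthonormal 𝕂 (fun l => WithLp.toLp 2 (fun i => X i l) : κ → EuclideanSpace 𝕂 ι) := by
    rw [orthonormal_iff_ite]
    intro a b
    have := congrFun (congrFun hX a) b
    simpa [Matrix.mul_apply, Matrix.one_apply, PiLp.inner_apply, mul_comm] using this
  have h := hon.sum_inner_products_le (WithLp.toLp 2 v) (s := Finset.univ)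
  rw [EuclideanSpace.norm_sq_eq] at h
  simpa [Matrix.mulVec, dotProduct, PiLp.inner_apply, mul_comm] using h

/-- The rows of a matrix with orthonormal columns form a Parseval frame. -/
theorem sum_norm_sq_inner_row {ι κ : Type*} [Fintype ι] [Fintype κ] [DecidableEq κ]
    {X : Matrix ι κ 𝕂} (hX : X.conjTranspose * X = 1) (u : EuclideanSpace 𝕂 κ) :
    ∑ i, ‖inner 𝕂 (WithLp.toLp 2 (X i) : EuclideanSpace 𝕂 κ) u‖ ^ 2 = ‖u‖ ^ 2 := by
  -- The inner product conjugates one argument, so up to conjugation it is `X` applied to the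
  -- conjugate of `u`; norms are unaffected.
  have h := sum_norm_sq_mulVec hX (star u.ofLp)
  rw [EuclideanSpace.norm_sq_eq]
  simp only [Pi.star_apply, norm_star] at h
  rw [← h]
  refine Finset.sum_congr rfl fun i _ => ?_
  rw [norm_inner_symm]
  simp [PiLp.inner_apply, Matrix.mulVec, dotProduct]

/-- A matrix whose rows span has a left inverse. -/
theorem exists_left_inverse_of_span_row {ι κ : Type*} [Fintype ι] [Fintype κ] [DecidableEq κ]
    {M : Matrix ι κ 𝕂}
    (hM : Submodule.span 𝕂 (Set.range fun a => (WithLp.toLp 2 (M a) : EuclideanSpace 𝕂 κ)) = ⊤) :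
    ∃ B : Matrix κ ι 𝕂, B * M = 1 := by
  rw [← Matrix.vecMul_surjective_iff_exists_left_inverse]
  have h : Submodule.span 𝕂 (Set.range M.row) = ⊤ := by
    have := congrArg (Submodule.map (WithLp.linearEquiv 2 𝕂 (κ → 𝕂)).toLinearMap) hM
    rw [Submodule.map_span, ← Set.range_comp, Submodule.map_top, LinearEquiv.range] at this
    exact this
  rw [← range_vecMulLinear, LinearMap.range_eq_top] at h
  exact h

end Isometry

/-! ### Truncating a full SVD to the rank. -/

section ThinSVD

variable {𝕂 : Type*} [RCLike 𝕂]

/-- The first `k` columns of a square matrix. -/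
def firstCols {N k : ℕ} (h : k ≤ N) (X : Matrix (Fin N) (Fin N) 𝕂) : Matrix (Fin N) (Fin k) 𝕂 :=
  X.submatrix id (Fin.castLE h)

theorem firstCols_conjTranspose_mul_self {N k : ℕ} (h : k ≤ N) {X : Matrix (Fin N) (Fin N) 𝕂}
    (hX : X ∈ Matrix.unitaryGroup (Fin N) 𝕂) :
    (firstCols h X).conjTranspose * firstCols h X = 1 := by
  rw [firstCols, Matrix.conjTranspose_submatrix,
    ← Matrix.submatrix_mul _ _ _ id _ Function.bijective_id, ← Matrix.star_eq_conjTranspose,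
    Matrix.mem_unitaryGroup_iff'.mp hX, Matrix.submatrix_one _ (Fin.castLE_injective h)]

theorem levProb_eq_firstCols {N k : ℕ} (h : k ≤ N) (X : Matrix (Fin N) (Fin N) 𝕂) (j : Fin N) :
    levProb X k j = 1 / k * ∑ l, ‖firstCols h X j l‖ ^ 2 := by
  rw [levProb, Finset.sum_filter]
  congr 1
  symm
  refine Fintype.sum_of_injective (Fin.castLE h) (Fin.castLE_injective h) _ _ ?_ ?_
  · intro i hi
    rw [if_neg fun hik => hi ⟨⟨i, hik⟩, rfl⟩]
  · intro l
    simp [firstCols]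

variable {m n : ℕ} {A : Matrix (Fin m) (Fin n) 𝕂}

theorem finrank_range_toEuclideanLin (A : Matrix (Fin m) (Fin n) 𝕂) :
    Module.finrank 𝕂 (Matrix.toEuclideanLin A).range = A.rank := by
  rw [Matrix.toEuclideanLin_eq_toLin_orthonormal, ← Matrix.rank_eq_finrank_range_toLin]

theorem singVal_eq_zero_iff {i : ℕ} : singVal A i = 0 ↔ A.rank ≤ i := by
  rw [singVal, ← finrank_range_toEuclideanLin]
  exact LinearMap.singularValues_eq_zero_iff_le_finrank_range _

theorem singVal_pos {i : ℕ} (hi : i < A.rank) : 0 < singVal A i :=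
  lt_of_le_of_ne (LinearMap.singularValues_nonneg _ _) fun h =>
    (singVal_eq_zero_iff.mp h.symm).not_gt hi

theorem singVal_antitone : Antitone (singVal A) := LinearMap.singularValues_antitone _

/-- Singular values of index at least the rank vanish, so only the first `A.rank` columns of `W` and
`V` survive in the product. -/
theorem IsSVD.eq_thin {W : Matrix (Fin m) (Fin m) 𝕂} {V : Matrix (Fin n) (Fin n) 𝕂}
    (h : IsSVD A W V) (hm : A.rank ≤ m) (hn : A.rank ≤ n) :
    A = firstCols hm W * (Matrix.diagonal (fun l : Fin A.rank => ((singVal A l : ℝ) : 𝕂)) *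
      (firstCols hn V).conjTranspose) := by
  conv_lhs => rw [h.factorization]
  ext a b
  rw [Matrix.mul_apply, Matrix.mul_apply]
  symm
  refine Fintype.sum_of_injective (Fin.castLE hn) (Fin.castLE_injective hn) _ _ ?_ ?_
  · intro j hj
    have hj' : singVal A j = 0 := by
      rw [singVal_eq_zero_iff]
      exact not_lt.mp fun hjk => hj ⟨⟨j, hjk⟩, rfl⟩
    rw [Matrix.mul_apply, Finset.sum_eq_zero, zero_mul]
    intro i _
    by_cases hij : (i : ℕ) = j
    · simp [hij, hj']
    · simp [hij]
  · intro l
    rw [Matrix.diagonal_mul, Matrix.mul_apply, Finset.sum_eq_single (Fin.castLE hm l)]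
    · simp [firstCols, mul_assoc]
    · intro i _ hi
      have : (i : ℕ) ≠ l := fun h => hi (Fin.ext h)
      simp [this]
    · simp

end ThinSVD

/-! ### Norms and exact CUR from a factorization `X D Yᴴ`. -/

section Deterministic

variable {𝕂 : Type*} [RCLike 𝕂] {m n k : ℕ} {A : Matrix (Fin m) (Fin n) 𝕂}
  {X : Matrix (Fin m) (Fin k) 𝕂} {Y : Matrix (Fin n) (Fin k) 𝕂} {s : Fin k → ℝ}

theorem sum_norm_sq_col (hX : X.conjTranspose * X = 1)
    (hA : A = X * (Matrix.diagonal (fun l => (s l : 𝕂)) * Y.conjTranspose)) (j : Fin n) :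
    ∑ i, ‖A i j‖ ^ 2 = ∑ l, s l ^ 2 * ‖Y j l‖ ^ 2 := by
  rw [hA, sum_norm_sq_mul_apply hX]
  simp [Matrix.diagonal_mul, mul_pow]

/-- This is the column identity for `Aᴴ`: since `s` is real, conjugate transposition only swaps `X`
and `Y`. -/
theorem sum_norm_sq_row (hY : Y.conjTranspose * Y = 1)
    (hA : A = X * (Matrix.diagonal (fun l => (s l : 𝕂)) * Y.conjTranspose)) (i : Fin m) :
    ∑ j, ‖A i j‖ ^ 2 = ∑ l, s l ^ 2 * ‖X i l‖ ^ 2 := by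
  have hA' : A.conjTranspose =
      Y * (Matrix.diagonal (fun l => (s l : 𝕂)) * X.conjTranspose) := by
    rw [hA]
    simp only [Matrix.conjTranspose_mul, Matrix.conjTranspose_conjTranspose,
      Matrix.diagonal_conjTranspose, Matrix.mul_assoc]
    congr 3
    ext l
    simp
  rw [← sum_norm_sq_col hY hA' i]
  simp

theorem frobSq_eq_sum (hX : X.conjTranspose * X = 1) (hY : Y.conjTranspose * Y = 1)
    (hA : A = X * (Matrix.diagonal (fun l => (s l : 𝕂)) * Y.conjTranspose)) :
    frobSq A = ∑ l, s l ^ 2 := by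
  rw [frobSq, Finset.sum_comm]
  simp only [sum_norm_sq_col hX hA]
  rw [Finset.sum_comm]
  refine Finset.sum_congr rfl fun l _ => ?_
  have h := sum_norm_sq_mulVec hY (Pi.single l 1)
  rw [← Finset.mul_sum]
  have h1 : ∑ i, ‖(Pi.single l 1 : Fin k → 𝕂) i‖ ^ 2 = 1 := by
    rw [Finset.sum_eq_single l] <;> simp +contextual
  simp only [Matrix.mulVec_single_one, Matrix.col_apply, h1] at h
  rw [h, mul_one]

/-- The test vector is the `l`-th column of `Y`: it has unit norm and is mapped to `s l` times the
`l`-th column of `X`. -/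
theorem le_specNorm (hX : X.conjTranspose * X = 1) (hY : Y.conjTranspose * Y = 1)
    (hs : ∀ l, 0 ≤ s l)
    (hA : A = X * (Matrix.diagonal (fun l => (s l : 𝕂)) * Y.conjTranspose)) (l : Fin k) :
    s l ≤ specNorm A := by
  have h1 : ∑ i, ‖(Pi.single l 1 : Fin k → 𝕂) i‖ ^ 2 = 1 := by
    rw [Finset.sum_eq_single l] <;> simp +contextual
  have hy : ‖(WithLp.toLp 2 (Y.mulVec (Pi.single l 1)) : EuclideanSpace 𝕂 (Fin n))‖ = 1 := by
    rw [← sq_eq_sq₀ (norm_nonneg _) zero_le_one, EuclideanSpace.norm_sq_eq, one_pow]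
    exact (sum_norm_sq_mulVec hY _).trans h1
  have h := (Matrix.toEuclideanLin A).toContinuousLinearMap.le_opNorm
    (WithLp.toLp 2 (Y.mulVec (Pi.single l 1)))
  rw [hy, mul_one] at h
  refine le_trans (le_of_eq ?_) h
  rw [← sq_eq_sq₀ (hs l) (norm_nonneg _), EuclideanSpace.norm_sq_eq]
  have h2 : A.mulVec (Y.mulVec (Pi.single l 1)) = X.mulVec (Pi.single l (s l : 𝕂)) := by
    rw [Matrix.mulVec_mulVec, hA, Matrix.mul_assoc, Matrix.mul_assoc, hY, Matrix.mul_one,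
      ← Matrix.mulVec_mulVec]
    simp
  have h3 := sum_norm_sq_mulVec hX (Pi.single l (s l : 𝕂))
  rw [← h2, Finset.sum_eq_single (a := l) (s := Finset.univ)] at h3
  · simpa [Matrix.toLpLin_apply] using h3.symm
  · intro b _ hb
    simp [hb]
  · simp

/-- `X` preserves norms, the diagonal factor scales by at most `b`, and `Yᴴ` is a contraction by
Bessel. -/
theorem specNorm_le (hX : X.conjTranspose * X = 1) (hY : Y.conjTranspose * Y = 1)
    (hs : ∀ l, 0 ≤ s l)
    (hA : A = X * (Matrix.diagonal (fun l => (s l : 𝕂)) * Y.conjTranspose)) {b : ℝ} (hb : 0 ≤ b)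
    (hsb : ∀ l, s l ≤ b) : specNorm A ≤ b := by
  refine ContinuousLinearMap.opNorm_le_bound _ hb fun x => ?_
  rw [← sq_le_sq₀ (norm_nonneg _) (by positivity), EuclideanSpace.norm_sq_eq, mul_pow,
    EuclideanSpace.norm_sq_eq]
  have h1 : A.mulVec x.ofLp = X.mulVec fun l => (s l : 𝕂) * Y.conjTranspose.mulVec x.ofLp l := by
    rw [hA, ← Matrix.mulVec_mulVec, ← Matrix.mulVec_mulVec]
    congr 1
    ext l
    rw [Matrix.mulVec_diagonal]
  calc ∑ i, ‖A.mulVec x.ofLp i‖ ^ 2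
      = ∑ l, s l ^ 2 * ‖Y.conjTranspose.mulVec x.ofLp l‖ ^ 2 := by
        rw [h1, sum_norm_sq_mulVec hX]
        simp [mul_pow]
    _ ≤ ∑ l, b ^ 2 * ‖Y.conjTranspose.mulVec x.ofLp l‖ ^ 2 := by
        gcongr with l
        · exact hs l
        · exact hsb l
    _ ≤ _ := by
        rw [← Finset.mul_sum]
        gcongr
        exact sum_norm_sq_conjTranspose_mulVec_le hY _

/-- If the sampled factors have full rank, then the sampled core has full rank and the CUR
decomposition is exact. -/
theorem cur_exact {d₁ d₂ : ℕ} (f : Fin d₁ → Fin m) (g : Fin d₂ → Fin n)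
    (hs : ∀ l, s l ≠ 0)
    (hA : A = X * (Matrix.diagonal (fun l => (s l : 𝕂)) * Y.conjTranspose))
    (hf : ∃ B : Matrix (Fin k) (Fin d₁) 𝕂, B * X.submatrix f id = 1) 
    (hg : ∃ B : Matrix (Fin k) (Fin d₂) 𝕂, B * Y.submatrix g id = 1) :
    (A.submatrix f g).rank = k ∧
      A = A.submatrix id g * pinv (A.submatrix f g) * A.submatrix f id := by
  obtain ⟨B, hB⟩ := hf
  obtain ⟨B', hB'⟩ := hg
  set D : Matrix (Fin k) (Fin k) 𝕂 := Matrix.diagonal fun l => (s l : 𝕂)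
  set D' : Matrix (Fin k) (Fin k) 𝕂 := Matrix.diagonal fun l => (s l : 𝕂)⁻¹
  have hDD : D * D' = 1 := by simp [D, D', Matrix.diagonal_mul_diagonal, hs]
  set F := X.submatrix f id
  set G := D * (Y.submatrix g id).conjTranspose
  -- The core factors as `U = F * G`, where `F` has the left inverse `B` and `G` the right inverse
  -- `H`.
  set H := B'.conjTranspose * D'
  have hG : G * H = 1 := by
    have : (Y.submatrix g id).conjTranspose * B'.conjTranspose = 1 := by
      rw [← Matrix.conjTranspose_mul, hB', Matrix.conjTranspose_one]
    calc G * H = D * ((Y.submatrix g id).conjTranspose * B'.conjTranspose) * D' := by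
          simp only [G, H, Matrix.mul_assoc]
      _ = 1 := by rw [this, Matrix.mul_one, hDD]
  have hU : A.submatrix f g = F * G := by
    rw [hA]; ext; simp [F, G, Matrix.mul_apply]
  have hC : A.submatrix id g = X * G := by
    rw [hA]; ext; simp [G, Matrix.mul_apply]
  have hR : A.submatrix f id = F * (D * Y.conjTranspose) := by
    rw [hA]; ext; simp [F, Matrix.mul_apply]
  rw [hU, hC, hR]
  have hP := (pinv_spec (F * G)).mul_mul_left
  set P := pinv (F * G)
  constructor
  · refine le_antisymm ((Matrix.rank_mul_le_left F G).trans
      ((Matrix.rank_le_card_width F).trans (by simp))) ?_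
    have h1 : B * (F * G) * H = 1 := by
      calc B * (F * G) * H = (B * F) * (G * H) := by simp only [Matrix.mul_assoc]
        _ = 1 := by rw [hB, hG, Matrix.mul_one]
    calc k = (B * (F * G) * H).rank := by rw [h1, Matrix.rank_one, Fintype.card_fin]
      _ ≤ (F * G).rank := (Matrix.rank_mul_le_left _ _).trans (Matrix.rank_mul_le_right _ _)
  -- Only the Penrose equation `U P U = U` matters: cancelling `F` on the left and `G` on the right
  -- turns it into `G P F = 1`.
  · have h1 : G * P * F = 1 := by
      calc G * P * F = (B * F) * (G * P * F) * (G * H) := by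
            rw [hB, hG, Matrix.one_mul, Matrix.mul_one]
        _ = B * (F * G * P * (F * G)) * H := by simp only [Matrix.mul_assoc]
        _ = (B * F) * (G * H) := by rw [hP]; simp only [Matrix.mul_assoc]
        _ = 1 := by rw [hB, hG, Matrix.mul_one]
    calc A = X * (G * P * F) * (D * Y.conjTranspose) := by rw [h1, Matrix.mul_one, hA]
      _ = _ := by simp only [Matrix.mul_assoc]

end Deterministic

/-- The coupon-collector failure probability is dominated by the tail in the sampling bound. -/
theorem mul_pow_le_exp_mul_one_sub_exp {k d : ℕ} {r δ x : ℝ} (hk : 0 < k) (hr : 1 ≤ r)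
    (hrk : r ≤ k) (hδ : 0 < δ) (hδ1 : δ < 1) (hx : k / δ < x)
    (hd : 4 * (x * Real.log x) ≤ d) :
    (k : ℝ) * (1 - 1 / k) ^ d ≤
      2 * (Real.exp (-(r / (k * δ))) * (1 - Real.exp (-(r / (k * δ))))) := by
  have hk0 : (0 : ℝ) < k := by exact_mod_cast hk
  have hk1 : (1 : ℝ) ≤ k := by exact_mod_cast hk
  have hkδ : (k : ℝ) < k / δ := by
    rw [lt_div_iff₀ hδ]
    nlinarith
  have hlog : Real.log k ≤ Real.log x := Real.log_le_log hk0 (hkδ.trans hx).le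
  have hx1 : 1 < x := by linarith
  -- With `t = r/(kδ)`, the bounds `1/k ≤ t ≤ 1/δ` give `1 - exp(-t) ≥ 1/(2k)` and `exp(-t) ≥
  -- exp(-1/δ)`. The target is therefore at least `exp(-1/δ)/k`.
  have hy1 : 1 / k ≤ r / (k * δ) := by
    rw [div_le_div_iff₀ hk0 (by positivity)]
    nlinarith [mul_le_mul hr hδ1.le hδ.le (by linarith)]
  have hy2 : r / (k * δ) ≤ 1 / δ := by
    rw [div_le_div_iff₀ (by positivity) hδ]
    nlinarith
  have hexp : Real.exp (-(r / (k * δ))) ≤ Real.exp (-(1 / k)) := Real.exp_le_exp.mpr (by linarith)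
  have hexp1 : Real.exp (-(1 / (k : ℝ))) ≤ 1 - 1 / (2 * k) := by
    have h1 := Real.add_one_le_exp (1 / (k : ℝ))
    rw [Real.exp_neg, inv_le_comm₀ (Real.exp_pos _) ?_]
    · refine le_trans ?_ h1
      rw [inv_le_iff_one_le_mul₀ ?_]
      · field_simp
        nlinarith
      · rw [sub_pos, div_lt_one (by positivity)]
        linarith
    · rw [sub_pos, div_lt_one (by positivity)]
      linarith
  -- For `k = 1` the left side is `0 ^ d`, which vanishes because `x log x > 0` forces `d ≥ 1`. For
  -- `k ≥ 2`, `log k ≥ 1/2` is available.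
  rcases (Nat.succ_le_of_lt hk).eq_or_lt with h | h
  · have hd0 : d ≠ 0 := by
      rintro rfl
      have := mul_pos (zero_lt_one.trans hx1) (Real.log_pos hx1)
      norm_num at hd
      linarith
    subst h
    have : 0 ≤ 1 - Real.exp (-(r / ((1 : ℕ) * δ))) := by
      have := Real.exp_pos (-(1 / ((1 : ℕ) : ℝ)))
      norm_num at hexp hexp1 ⊢
      linarith
    simp only [Nat.cast_one, div_one, sub_self, zero_pow hd0, mul_zero] at *
    positivity
  · have hk2 : (2 : ℝ) ≤ k := by exact_mod_cast h
    have hl : 1 / 2 ≤ Real.log k := by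
      have := Real.log_le_log two_pos hk2
      have := Real.log_two_gt_d9
      linarith
    -- Half of `4 (log k)/δ` covers `2 log k` because `1/δ > 1`, and the other half covers `1/δ`
    -- because `log k ≥ 1/2`. Then `k exp(-d/k) ≤ exp(-1/δ)/k`.
    have hdk : 2 * Real.log k + 1 / δ ≤ d / k := by
      rw [le_div_iff₀ hk0]
      have h1 : 4 * (k / δ * Real.log k) ≤ d := by
        refine le_trans ?_ hd
        gcongr
      refine le_trans ?_ h1
      have h2 : 1 < 1 / δ := by rwa [lt_div_iff₀ hδ, one_mul]
      have h3 : k / δ = k * (1 / δ) := by ring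
      rw [h3]
      have h4 : 2 * Real.log k + 1 / δ ≤ 4 * (1 / δ * Real.log k) := by nlinarith
      nlinarith
    have hpow : (1 - 1 / (k : ℝ)) ^ d ≤ Real.exp (-(d / k)) := by
      have h1 := Real.one_sub_le_exp_neg (1 / (k : ℝ))
      have h0 : 0 ≤ 1 - 1 / (k : ℝ) := by
        rw [sub_nonneg, div_le_one hk0]
        exact hk1
      refine (pow_le_pow_left₀ h0 h1 d).trans_eq ?_
      rw [← Real.exp_nat_mul]
      congr 1
      ring
    calc (k : ℝ) * (1 - 1 / k) ^ d ≤ k * Real.exp (-(2 * Real.log k + 1 / δ)) := by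
          gcongr
          exact hpow.trans (Real.exp_le_exp.mpr (by linarith))
      _ = 2 * (Real.exp (-(1 / δ)) * (1 / (2 * k))) := by
          rw [neg_add, Real.exp_add, Real.exp_neg (2 * _), two_mul, Real.exp_add,
            Real.exp_log hk0]
          field_simp
      _ ≤ _ := by
          gcongr
          linarith

/-! ### Stable rank, condition number and leverage scores. -/

section Spectrum

variable {𝕂 : Type*} [RCLike 𝕂] {m n : ℕ} {A : Matrix (Fin m) (Fin n) 𝕂}

/-- Here `r = ∑ σ_l² / σ_1²` has `k` terms, each between `κ⁻²` and `1`, and the first equals `1`.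
The lower bound by `k κ⁻²` is what turns the condition on `ε` into a sample size beyond `k/δ`. -/
theorem stableRank_bounds (hA : A ≠ 0) :
    0 < specNorm A ∧ specNorm A = singVal A 0 ∧ 0 < frobSq A ∧ 1 ≤ stableRank A ∧
      stableRank A ≤ A.rank ∧ A.rank * (condNumber A)⁻¹ ^ 2 ≤ stableRank A ∧
      (condNumber A)⁻¹ ≤ 1 := by
  obtain ⟨W, V, h⟩ := exists_isSVD A
  have hm := A.rank_le_height
  have hn := A.rank_le_width
  have hX := firstCols_conjTranspose_mul_self hm h.left_unitary
  have hY := firstCols_conjTranspose_mul_self hn h.right_unitary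
  have hAe := h.eq_thin hm hn
  have hs : ∀ l : Fin A.rank, 0 ≤ singVal A l := fun l => (singVal_pos l.2).le
  have hk : 0 < A.rank := by
    rw [Nat.pos_iff_ne_zero]
    intro h0
    refine hA (hAe.trans ?_)
    ext i j
    have : IsEmpty (Fin A.rank) := by rw [h0]; infer_instance
    simp [Matrix.mul_apply]
  have hσ : 0 < singVal A 0 := singVal_pos hk
  have hσ' : 0 < singVal A (A.rank - 1) := singVal_pos (by omega)
  have hspec : specNorm A = singVal A 0 :=
    le_antisymm (specNorm_le hX hY hs hAe hσ.le fun l => singVal_antitone (Nat.zero_le _))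
      (le_specNorm hX hY hs hAe ⟨0, hk⟩)
  have hfrob := frobSq_eq_sum hX hY hAe
  have h1 : singVal A 0 ^ 2 ≤ frobSq A := by
    rw [hfrob]
    exact Finset.single_le_sum (f := fun l : Fin A.rank => singVal A l ^ 2)
      (fun l _ => sq_nonneg _) (Finset.mem_univ (⟨0, hk⟩ : Fin A.rank))
  refine ⟨hspec ▸ hσ, hspec, (by positivity : 0 < singVal A 0 ^ 2).trans_le h1, ?_, ?_, ?_, ?_⟩
  · rw [stableRank, hspec, one_le_div (by positivity)]
    exact h1
  · rw [stableRank, hspec, div_le_iff₀ (by positivity), hfrob]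
    refine (Finset.sum_le_card_nsmul _ _ (singVal A 0 ^ 2) fun l _ => ?_).trans_eq (by simp)
    exact pow_le_pow_left₀ (hs l) (singVal_antitone (Nat.zero_le _)) 2
  · rw [stableRank, hspec, condNumber, inv_div, div_pow, le_div_iff₀ (by positivity), mul_assoc,
      div_mul_cancel₀ _ (by positivity), hfrob]
    refine (by simp : _ = _).trans_le
      (Finset.card_nsmul_le_sum Finset.univ _ (singVal A (A.rank - 1) ^ 2) fun l _ => ?_)
    exact pow_le_pow_left₀ hσ'.le (singVal_antitone (by omega)) 2
  · rw [condNumber, inv_div]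
    exact div_le_one_of_le₀ (singVal_antitone (Nat.zero_le _)) hσ.le

/-- Leverage scores dominate the rescaled length-squared probabilities. -/
theorem stableRank_div_mul_prob_le {N k : ℕ} (hA : A ≠ 0) {q : ℝ} {Z : Matrix (Fin N) (Fin k) 𝕂}
    {i : Fin N} {s : Fin k → ℝ} (hs : ∀ l, 0 ≤ s l) (hsb : ∀ l, s l ≤ specNorm A)
    (hq : q = (∑ l, s l ^ 2 * ‖Z i l‖ ^ 2) / frobSq A) :
    stableRank A / k * q ≤ 1 / k * ∑ l, ‖Z i l‖ ^ 2 := by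
  obtain ⟨hpos, -, hfrob, -⟩ := stableRank_bounds hA
  have h1 : stableRank A / k * q =
      1 / k * ((∑ l, s l ^ 2 * ‖Z i l‖ ^ 2) / specNorm A ^ 2) := by
    rw [hq, stableRank]
    field_simp
  rw [h1]
  gcongr
  rw [div_le_iff₀ (by positivity), Finset.sum_mul]
  refine Finset.sum_le_sum fun l _ => ?_
  rw [mul_comm]
  gcongr
  · exact hs l
  · exact hsb l

end Spectrum

/-! ### Leverage-score sampling of rows. -/

section Sampling

variable {𝕂 : Type*} [RCLike 𝕂] {Ω : Type*} [MeasurableSpace Ω] {μ : Measure Ω}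
  [IsProbabilityMeasure μ]

/-- Rows sampled by leverage scores span with high probability. -/
theorem measureReal_not_exists_left_inverse_le {N k d : ℕ} (hk : 0 < k)
    {X : Matrix (Fin N) (Fin k) 𝕂} (hX : X.conjTranspose * X = 1) {p : Fin N → ℝ}
    (hp : ∀ i, p i = 1 / k * ∑ l, ‖X i l‖ ^ 2) {I : Fin d → Ω → Fin N} (hI : iIndepFun I μ)
    (hlaw : ∀ a i, μ.real {ω | I a ω = i} = p i) :
    μ.real {ω | ¬ ∃ B : Matrix (Fin k) (Fin d) 𝕂, B * X.submatrix (fun a => I a ω) id = 1} ≤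
      k * (1 - 1 / k) ^ d := by
  have hw := sum_norm_sq_inner_row hX
  have hp' : ∀ i, p i = 1 / k * ‖(WithLp.toLp 2 (X i) : EuclideanSpace 𝕂 (Fin k))‖ ^ 2 :=
    fun i => by rw [hp, EuclideanSpace.norm_sq_eq]
  have hE : Module.finrank 𝕂 (EuclideanSpace 𝕂 (Fin k)) = k := by simp
  refine le_trans (measureReal_mono ?_ (measure_ne_top _ _))
    (measureReal_span_ne_top_le hw hk hE hp' hI hlaw)
  intro ω hω htop
  exact hω (exists_left_inverse_of_span_row htop)

end Sampling

end CUR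

theorem mainTheorem8 :
    ∃ C₀ c : ℝ, 0 < C₀ ∧ 0 < c ∧
      ∀ (𝕂 : Type) [RCLike 𝕂] (m n : ℕ) (A : Matrix (Fin m) (Fin n) 𝕂), A ≠ 0 →
      ∀ (k : ℕ) (r : ℝ), A.rank = k → CUR.stableRank A = r →
      ∀ (W : Matrix (Fin m) (Fin m) 𝕂) (V : Matrix (Fin n) (Fin n) 𝕂), CUR.IsSVD A W V →
        (∀ j, (r / k) * CUR.colProb A j ≤ CUR.levProb V k j) ∧
        (∀ i, (r / k) * CUR.rowProb A i ≤ CUR.levProb W k i) ∧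
        ∀ (α β γ δ ε : ℝ), α = √(r / k) → β = √(r / k) → γ = min α β →
          0 < δ → δ < 1 → 0 < ε →
          ε < min (CUR.condNumber A)⁻¹ (δ ^ (-(1 / 4) : ℝ) * √(2 * γ)) →
        ∀ d₁ d₂ : ℕ,
          C₀ * (r / (ε ^ 4 * δ) * Real.log (r / (ε ^ 4 * δ))) ≤ d₁ →
          C₀ * (r / (ε ^ 4 * δ) * Real.log (r / (ε ^ 4 * δ))) ≤ d₂ →
        ∀ (Ω : Type) [MeasurableSpace Ω] (μ : Measure Ω) [IsProbabilityMeasure μ]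
          (I : Fin d₁ → Ω → Fin m) (J : Fin d₂ → Ω → Fin n),
          (∀ a, Measurable (I a)) → (∀ b, Measurable (J b)) →
          iIndepFun I μ → iIndepFun J μ →
          IndepFun (fun ω a => I a ω) (fun ω b => J b ω) μ →
          (∀ a i, μ.real {ω | I a ω = i} = CUR.levProb W k i) →
          (∀ b j, μ.real {ω | J b ω = j} = CUR.levProb V k j) →
          (1 - 2 * Real.exp (-(c * r / (k * δ)))) ^ 2 ≤
            μ.real {ω |
              (A.submatrix (fun a => I a ω) (fun b => J b ω)).rank = k ∧
              A = A.submatrix id (fun b => J b ω) *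
                CUR.pinv (A.submatrix (fun a => I a ω) (fun b => J b ω)) *
                A.submatrix (fun a => I a ω) id} := by
  -- `C₀ = 4` is the constant required by `mul_pow_le_exp_mul_one_sub_exp`, whose exponent `r/(kδ)`
  -- corresponds to `c = 1`.
  refine ⟨4, 1, by norm_num, one_pos, ?_⟩
  intro 𝕂 _ m n A hA k r hk hr W V h
  subst hk hr
  have hm := A.rank_le_height
  have hn := A.rank_le_width
  have hX := CUR.firstCols_conjTranspose_mul_self hm h.left_unitary
  have hY := CUR.firstCols_conjTranspose_mul_self hn h.right_unitary
  have hAe := h.eq_thin hm hn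
  have hs : ∀ l : Fin A.rank, 0 < CUR.singVal A l := fun l => CUR.singVal_pos l.2
  have hsb := CUR.le_specNorm hX hY (fun l => (hs l).le) hAe
  obtain ⟨-, -, -, hr1, hrk, hrκ, hκ⟩ := CUR.stableRank_bounds hA
  refine ⟨fun j => ?_, fun i => ?_, ?_⟩
  · rw [CUR.levProb_eq_firstCols hn]
    refine CUR.stableRank_div_mul_prob_le hA (fun l => (hs l).le) hsb ?_
    rw [CUR.colProb, CUR.sum_norm_sq_col hX hAe]
  · rw [CUR.levProb_eq_firstCols hm]
    refine CUR.stableRank_div_mul_prob_le hA (fun l => (hs l).le) hsb ?_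
    rw [CUR.rowProb, CUR.sum_norm_sq_row hY hAe]
  · intro α β γ δ ε _ _ _ hδ hδ1 hε hεlt d₁ d₂ hd₁ hd₂ Ω _ μ _ I J _ _ hI hJ _ hlawI hlawJ
    have hk : 0 < A.rank := by exact_mod_cast zero_lt_one.trans_le (hr1.trans hrk)
    have hk0 : (0 : ℝ) < A.rank := by exact_mod_cast hk
    have hεκ : ε < (CUR.condNumber A)⁻¹ := hεlt.trans_le (min_le_left _ _)
    -- Since `ε < κ⁻¹ ≤ 1`, one has `k ε⁴ ≤ k ε² < k κ⁻² ≤ r`.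
    have hx : A.rank / δ < CUR.stableRank A / (ε ^ 4 * δ) := by
      have h1 : ε ^ 4 ≤ ε ^ 2 := pow_le_pow_of_le_one hε.le (hεκ.le.trans hκ) (by norm_num)
      have h2 : ε ^ 2 < (CUR.condNumber A)⁻¹ ^ 2 := pow_lt_pow_left₀ hεκ hε.le (by norm_num)
      rw [← div_div]
      gcongr
      rw [lt_div_iff₀ (by positivity)]
      exact (mul_lt_mul_of_pos_left (h1.trans_lt h2) hk0).trans_le hrκ
    have hbI := (CUR.measureReal_not_exists_left_inverse_le hk hX
      (CUR.levProb_eq_firstCols hm W) hI hlawI).trans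
      (CUR.mul_pow_le_exp_mul_one_sub_exp hk hr1 hrk hδ hδ1 hx hd₁)
    have hbJ := (CUR.measureReal_not_exists_left_inverse_le hk hY
      (CUR.levProb_eq_firstCols hn V) hJ hlawJ).trans
      (CUR.mul_pow_le_exp_mul_one_sub_exp hk hr1 hrk hδ hδ1 hx hd₂)
    set SI := {ω | ¬ ∃ B : Matrix (Fin A.rank) (Fin d₁) 𝕂,
      B * (CUR.firstCols hm W).submatrix (fun a => I a ω) id = 1}
    set SJ := {ω | ¬ ∃ B : Matrix (Fin A.rank) (Fin d₂) 𝕂,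
      B * (CUR.firstCols hn V).submatrix (fun b => J b ω) id = 1}
    set G := {ω | (A.submatrix (fun a => I a ω) (fun b => J b ω)).rank = A.rank ∧
      A = A.submatrix id (fun b => J b ω) *
        CUR.pinv (A.submatrix (fun a => I a ω) (fun b => J b ω)) *
        A.submatrix (fun a => I a ω) id}
    -- The good event may fail only where the row or the column sample fails to span. Subadditivity
    -- of `μ.real` then suffices, with no measurability of these sets.
    have hcover : Set.univ ⊆ G ∪ (SI ∪ SJ) := by
      intro ω _
      by_cases hωI : ω ∈ SI
      · exact Or.inr (Or.inl hωI)
      by_cases hωJ : ω ∈ SJ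
      · exact Or.inr (Or.inr hωJ)
      exact Or.inl (CUR.cur_exact _ _ (fun l => (hs l).ne') hAe (not_not.mp hωI)
        (not_not.mp hωJ))
    have h1 : 1 ≤ μ.real G + (μ.real SI + μ.real SJ) := by
      calc 1 = μ.real Set.univ := by simp
        _ ≤ μ.real (G ∪ (SI ∪ SJ)) := measureReal_mono hcover (measure_ne_top _ _)
        _ ≤ _ := (measureReal_union_le _ _).trans
          (add_le_add le_rfl (measureReal_union_le _ _))
    -- Each bad event costs at most `2e(1 - e)`, and `1 - 4e(1 - e) = (1 - 2e)²` holds whatever the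
    -- sign of `1 - 2e`.
    rw [one_mul]
    linarith
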